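/- Theorem 6.3. Let $M$ be a finite-dimensional (Hausdorff) $C^\infty$ manifold without boundary, let $\Psi$ be a $C^\infty$ tensor field of type $(1,1)$ on $M$ (for example a metallic structure), and let $V$ be a $C^\infty$ vector field on $M$. For a $C^\infty$ tensor field $\Phi$ of type $(1,1)$ on a manifold let $N_\Phi$ denote its Nijenhuis tensor, the tensor field of type $(1,2)$ given on vector fields by $$N_\Phi(X,Y)=[\Phi X,\Phi Y]-\Phi[\Phi X,Y]-\Phi[X,\Phi Y]+\Phi^2[X,Y].$$ Let $\Psi^C$ be the complete lift of $\Psi$ to the tangent bundle $TM$, i.e. the tensor field of type $(1,1)$ on $TM$ whose matrix in the coordinates $(x^h,y^h)$ induced by local coordinates $(x^h)$ of $M$ is $$\begin{pmatrix}\Psi^h_i&0\\ y^j\partial_j\Psi^h_i&\Psi^h_i\end{pmatrix}.$$ Let $\beta_V:M\to TM$, $x\mapsto(x,V(x))$, be the cross-section determined by $V$. For a vector field $X$ on $M$ let $BX=d\beta_V(X)$, with components $(X^h,X^i\partial_iV^h)$, and let $CX$ be the vertical lift of $X$, with components $(0,X^h)$; both are vector fields of $TM$ along $\beta_V(M)$.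 For a tensor field $K$ of type $(1,2)$ on $M$ let $L_VK$ be its Lie derivative, $(L_VK)(X,Y)=[V,K(X,Y)]-K([V,X],Y)-K(X,[V,Y])$. Then, for all $C^\infty$ vector fields $X,Y$ on $M$, along $\beta_V(M)$, $$N_{\Psi^C}(BX,BY)=B\bigl(N_\Psi(X,Y)\bigr)+C\bigl((L_VN_\Psi)(X,Y)\bigr).$$ Moreover, $N_{\Psi^C}(BX,BY)$ is tangent to $\beta_V(M)$ at every point of $\beta_V(M)$ for all $C^\infty$ vector fields $X,Y$ on $M$ if and only if $L_VN_\Psi=0$ on $M$. -/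

import Mathlib

open scoped Manifold ContDiff

noncomputable section

namespace TangentLift

/-! ### Smooth vector fields and tensor fields of type (1,1) -/

/-- The vector field `X` on `M` is of class `C^∞`. -/
def IsSmoothVectorField {E : Type*} [NormedAddCommGroup E] [NormedSpace ℝ E]
    {H : Type*} [TopologicalSpace H] (I : ModelWithCorners ℝ E H)
    {M : Type*} [TopologicalSpace M] [ChartedSpace H M] [IsManifold I ∞ M]
    (X : ∀ x : M, TangentSpace I x) : Prop :=
  ContMDiff I I.tangent ∞ (fun x => (⟨x, X x⟩ : TangentBundle I M))

/-- The field `Ψ` of endomorphisms of the tangent spaces is of class `C^∞`, i.e. it is a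
tensor field of type `(1,1)`: a `C^∞` section of the bundle `End(TM)`. -/
def IsSmoothEndField {E : Type*} [NormedAddCommGroup E] [NormedSpace ℝ E]
    {H : Type*} [TopologicalSpace H] (I : ModelWithCorners ℝ E H)
    {M : Type*} [TopologicalSpace M] [ChartedSpace H M] [IsManifold I ∞ M]
    (Ψ : ∀ x : M, TangentSpace I x →L[ℝ] TangentSpace I x) : Prop :=
  ContMDiff I (I.prod 𝓘(ℝ, E →L[ℝ] E)) ∞
    (fun x => (⟨x, Ψ x⟩ : Bundle.TotalSpace (E →L[ℝ] E)
      (fun x : M => TangentSpace I x →L[ℝ] TangentSpace I x)))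

/-! ### The Nijenhuis tensor -/

/-- `[ΦX, ΦY] - Φ[ΦX, Y] - Φ[X, ΦY] + Φ²[X, Y]` for vector fields `X`, `Y`. -/
def nijenhuisField {E : Type*} [NormedAddCommGroup E] [NormedSpace ℝ E]
    {H : Type*} [TopologicalSpace H] (I : ModelWithCorners ℝ E H)
    {M : Type*} [TopologicalSpace M] [ChartedSpace H M]
    (Φ : ∀ x : M, TangentSpace I x →L[ℝ] TangentSpace I x)
    (X Y : ∀ x : M, TangentSpace I x) (x : M) : TangentSpace I x :=
  VectorField.mlieBracket I (fun z => Φ z (X z)) (fun z => Φ z (Y z)) x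
    - Φ x (VectorField.mlieBracket I (fun z => Φ z (X z)) Y x)
    - Φ x (VectorField.mlieBracket I X (fun z => Φ z (Y z)) x)
    + Φ x (Φ x (VectorField.mlieBracket I X Y x))

/-- The Nijenhuis tensor `N_Φ` at the point `x`, evaluated on tangent vectors `v`, `w` at `x`:
the value at `x` of the Nijenhuis expression on vector fields extending `v` and `w`
(Mathlib's extension, smooth near `x`).  For smooth `Φ` the extension is
irrelevant, see `nijenhuis_apply`. -/
def nijenhuis {E : Type*} [NormedAddCommGroup E] [NormedSpace ℝ E]
    {H : Type*} [TopologicalSpace H] (I : ModelWithCorners ℝ E H)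
    {M : Type*} [TopologicalSpace M] [ChartedSpace H M] [IsManifold I ∞ M]
    (Φ : ∀ x : M, TangentSpace I x →L[ℝ] TangentSpace I x)
    (x : M) (v w : TangentSpace I x) : TangentSpace I x :=
  nijenhuisField I Φ (FiberBundle.extend E v) (FiberBundle.extend E w) x

/-- The Nijenhuis expression is antisymmetric in its two arguments. -/
theorem nijenhuisField_swap {E : Type*} [NormedAddCommGroup E] [NormedSpace ℝ E]
    {H : Type*} [TopologicalSpace H] (I : ModelWithCorners ℝ E H)
    {M : Type*} [TopologicalSpace M] [ChartedSpace H M]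
    (Φ : ∀ x : M, TangentSpace I x →L[ℝ] TangentSpace I x)
    (X Y : ∀ x : M, TangentSpace I x) (x : M) :
    nijenhuisField I Φ X Y x = - nijenhuisField I Φ Y X x := by
  unfold nijenhuisField
  rw [VectorField.mlieBracket_swap_apply (V := fun z => Φ z (X z)) (W := fun z => Φ z (Y z)),
    VectorField.mlieBracket_swap_apply (V := fun z => Φ z (X z)) (W := Y),
    VectorField.mlieBracket_swap_apply (V := X) (W := fun z => Φ z (Y z)),
    VectorField.mlieBracket_swap_apply (V := X) (W := Y)]
  simp only [map_neg]
  abel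

/-- The Nijenhuis expression is tensorial in its first argument. -/
theorem nijenhuisField_tensorialAt {E : Type*} [NormedAddCommGroup E] [NormedSpace ℝ E]
    [CompleteSpace E]
    {H : Type*} [TopologicalSpace H] (I : ModelWithCorners ℝ E H)
    {M : Type*} [TopologicalSpace M] [ChartedSpace H M] [IsManifold I ∞ M]
    (Φ : ∀ x : M, TangentSpace I x →L[ℝ] TangentSpace I x) (hΦ : IsSmoothEndField I Φ)
    (x : M) (Y : ∀ x : M, TangentSpace I x)
    (hY : MDifferentiableAt I I.tangent (fun z => (⟨z, Y z⟩ : TangentBundle I M)) x) :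
    TensorialAt I E (fun X : (∀ z : M, TangentSpace I z) => nijenhuisField I Φ X Y x) x := by
  have : IsManifold I 2 M := inferInstance
  have hΦx := (hΦ.mdifferentiable (by simp)) x
  have key : ∀ {σ : ∀ z : M, TangentSpace I z},
      MDifferentiableAt I I.tangent (fun z => (⟨z, σ z⟩ : TangentBundle I M)) x →
      MDifferentiableAt I I.tangent (fun z => (⟨z, Φ z (σ z)⟩ : TangentBundle I M)) x :=
    fun {σ} h => MDifferentiableAt.clm_bundle_apply (b := fun z : M => z) (v := σ) hΦx h
  constructor
  · intro f σ hf hσ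
    have e : (fun z => Φ z ((f • σ) z)) = f • (fun z => Φ z (σ z)) := by
      funext z; simp
    unfold nijenhuisField
    rw [e, VectorField.mlieBracket_smul_left hf (key hσ),
      VectorField.mlieBracket_smul_left hf (key hσ), VectorField.mlieBracket_smul_left hf hσ,
      VectorField.mlieBracket_smul_left hf hσ]
    simp only [map_add, map_smul, smul_add, smul_sub]
    module
  · intro σ σ' hσ hσ'
    have e : (fun z => Φ z ((σ + σ') z)) = (fun z => Φ z (σ z)) + (fun z => Φ z (σ' z)) := by
      funext z; simp
    unfold nijenhuisField
    rw [e, VectorField.mlieBracket_add_left (key hσ) (key hσ'),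
      VectorField.mlieBracket_add_left (key hσ) (key hσ'),
      VectorField.mlieBracket_add_left hσ hσ', VectorField.mlieBracket_add_left hσ hσ']
    simp only [map_add]
    abel

/-- The Nijenhuis tensor is well defined: on vector fields `X`, `Y` differentiable at `x` it has
the value `[ΦX, ΦY] - Φ[ΦX, Y] - Φ[X, ΦY] + Φ²[X, Y]` at `x`. -/
theorem nijenhuis_apply {E : Type*} [NormedAddCommGroup E] [NormedSpace ℝ E]
    [FiniteDimensional ℝ E]
    {H : Type*} [TopologicalSpace H] (I : ModelWithCorners ℝ E H)
    {M : Type*} [TopologicalSpace M] [ChartedSpace H M] [IsManifold I ∞ M]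
    (Φ : ∀ x : M, TangentSpace I x →L[ℝ] TangentSpace I x) (hΦ : IsSmoothEndField I Φ)
    (x : M) (X Y : ∀ x : M, TangentSpace I x)
    (hX : MDifferentiableAt I I.tangent (fun z => (⟨z, X z⟩ : TangentBundle I M)) x)
    (hY : MDifferentiableAt I I.tangent (fun z => (⟨z, Y z⟩ : TangentBundle I M)) x) :
    nijenhuis I Φ x (X x) (Y x) = nijenhuisField I Φ X Y x := by
  have : CompleteSpace E := FiniteDimensional.complete ℝ E
  refine TensorialAt.pointwise₂ (Φ := fun X Y => nijenhuisField I Φ X Y x)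
    (fun Z hZ => nijenhuisField_tensorialAt I Φ hΦ x Z hZ) (fun Z hZ => ?_)
    (FiberBundle.mdifferentiableAt_extend ..) hX (FiberBundle.mdifferentiableAt_extend ..) hY (by simp) (by simp)
  have h := nijenhuisField_tensorialAt I Φ hΦ x Z hZ
  constructor
  · intro f σ hf hσ
    simp only [nijenhuisField_swap I Φ Z]
    rw [h.smul hf hσ, smul_neg]
  · intro σ σ' hσ hσ'
    simp only [nijenhuisField_swap I Φ Z]
    rw [h.add hσ hσ', neg_add]

/-! ### The Lie derivative of a tensor field of type (1,2) -/

/-- The Lie derivative `L_V K` of a tensor field `K` of type `(1,2)`, evaluated at the point `x`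
on tangent vectors `v`, `w` at `x`: with `X`, `Y` extending `v`, `w`,
`(L_V K)(X, Y) = [V, K(X, Y)] - K([V, X], Y) - K(X, [V, Y])` at `x`.
For smooth `V` and `K` this does not depend on the extensions. -/
def lieDeriv {E : Type*} [NormedAddCommGroup E] [NormedSpace ℝ E]
    {H : Type*} [TopologicalSpace H] (I : ModelWithCorners ℝ E H)
    {M : Type*} [TopologicalSpace M] [ChartedSpace H M] [IsManifold I ∞ M]
    (V : ∀ x : M, TangentSpace I x)
    (K : ∀ x : M, TangentSpace I x → TangentSpace I x → TangentSpace I x)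
    (x : M) (v w : TangentSpace I x) : TangentSpace I x :=
  let X : ∀ z : M, TangentSpace I z := FiberBundle.extend E v
  let Y : ∀ z : M, TangentSpace I z := FiberBundle.extend E w
  VectorField.mlieBracket I V (fun z => K z (X z) (Y z)) x
    - K x (VectorField.mlieBracket I V X x) w
    - K x v (VectorField.mlieBracket I V Y x)

/-! ### The complete lift to the tangent bundle

The tangent space of `TM` at `u = (x, y)` is, in Mathlib, the space `E × E` of components with
respect to the coordinates `(x^h, y^h)` of `TM` induced by the preferred chart of `M` at `x`. -/

/-- The complete lift `Ψ^C` of a tensor field `Ψ` of type `(1,1)` to `TM`. In the induced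
coordinates `(x^h, y^h)` its matrix at `u = (x, y)` is
`[[Ψ^h_i, 0], [∂Ψ^h_i, Ψ^h_i]]` where `∂Ψ^h_i = y^j ∂_j Ψ^h_i`; that is, `Ψ^C` maps the vector
with components `(a, b)` to the one with components `(Ψ a, (∂Ψ) a + Ψ b)`. -/
def completeLift {E : Type*} [NormedAddCommGroup E] [NormedSpace ℝ E]
    {H : Type*} [TopologicalSpace H] (I : ModelWithCorners ℝ E H)
    {M : Type*} [TopologicalSpace M] [ChartedSpace H M] [IsManifold I ∞ M]
    (Ψ : ∀ x : M, TangentSpace I x →L[ℝ] TangentSpace I x) (u : TangentBundle I M) :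
    TangentSpace I.tangent u →L[ℝ] TangentSpace I.tangent u :=
  let P : E →L[ℝ] E := Ψ u.proj
  -- `D` is the matrix `y^j ∂_j Ψ^h_i` in the preferred chart at the base point of `u`
  let D : E →L[ℝ] E :=
    mfderiv I 𝓘(ℝ, E →L[ℝ] E)
      (fun z : M => inTangentCoordinates I I id id (fun z : M => Ψ z) u.proj z) u.proj u.snd
  ((P.comp (ContinuousLinearMap.fst ℝ E E)).prod
    (D.comp (ContinuousLinearMap.fst ℝ E E) + P.comp (ContinuousLinearMap.snd ℝ E E)) :
      E × E →L[ℝ] E × E)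

/-! ### The cross-section determined by a vector field -/

/-- The cross-section `β_V : M → TM`, `x ↦ (x, V x)`. -/
def crossSection {E : Type*} [NormedAddCommGroup E] [NormedSpace ℝ E]
    {H : Type*} [TopologicalSpace H] (I : ModelWithCorners ℝ E H)
    {M : Type*} [TopologicalSpace M] [ChartedSpace H M]
    (V : ∀ x : M, TangentSpace I x) (x : M) : TangentBundle I M :=
  ⟨x, V x⟩

/-- `B`, the differential of `β_V` at `x`: `v ↦ (v^h, v^i ∂_i V^h)`, a tangent vector of `TM` at
`β_V x`. -/
def liftB {E : Type*} [NormedAddCommGroup E] [NormedSpace ℝ E]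
    {H : Type*} [TopologicalSpace H] (I : ModelWithCorners ℝ E H)
    {M : Type*} [TopologicalSpace M] [ChartedSpace H M] [IsManifold I ∞ M]
    (V : ∀ x : M, TangentSpace I x) (x : M) :
    TangentSpace I x →L[ℝ] TangentSpace I.tangent (crossSection I V x) :=
  mfderiv I I.tangent (crossSection I V) x

/-- `C`, the vertical lift along `β_V` at `x`: `v ↦ (0, v^h)`, a tangent vector of `TM` at `β_V x`
that is tangent to the fibre. -/
def liftC {E : Type*} [NormedAddCommGroup E] [NormedSpace ℝ E]
    {H : Type*} [TopologicalSpace H] (I : ModelWithCorners ℝ E H)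
    {M : Type*} [TopologicalSpace M] [ChartedSpace H M] [IsManifold I ∞ M]
    (V : ∀ x : M, TangentSpace I x) (x : M) :
    TangentSpace I x →L[ℝ] TangentSpace I.tangent (crossSection I V x) :=
  (ContinuousLinearMap.inr ℝ E E : E →L[ℝ] E × E)

/-- The tangent vector `ξ` of `TM` at `β_V x` is tangent to the submanifold `β_V(M)`, i.e. it lies
in the image of the differential of the embedding `β_V` at `x`. -/
def IsTangentToCrossSection {E : Type*} [NormedAddCommGroup E] [NormedSpace ℝ E]
    {H : Type*} [TopologicalSpace H] (I : ModelWithCorners ℝ E H)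
    {M : Type*} [TopologicalSpace M] [ChartedSpace H M] [IsManifold I ∞ M]
    (V : ∀ x : M, TangentSpace I x) (x : M)
    (ξ : TangentSpace I.tangent (crossSection I V x)) : Prop :=
  ξ ∈ Set.range (mfderiv I I.tangent (crossSection I V) x)

end TangentLift

end

/-! The statement is local, so everything is read in a chart. Write `Φ` for the matrix of the tensor
field in the chart at `x`, and `D` for the derivative of the components of `V` at the centre. On
constant fields the Lie brackets collapse to first derivatives of `Φ`, and the Nijenhuis tensor
becomes the explicit expression `modelNijenhuis` (`nijenhuis_eq_modelNijenhuis`).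

The core is an identity on `F × F`: the Nijenhuis tensor `N` of `Φ` is compatible with complete
lifts. At `(e, y)`, on `(a, b)` and `(c, d)`, the lifted tensor has components `N(a, c)` and `∂_y
N(a, c) + N(a, d) + N(b, c)` (`modelNijenhuis_modelCompleteLift`); besides the product rule this
uses only the symmetry of the second derivative.

Along the cross-section `y = V`, `b = D a` and `d = D c`. In the chart, `(L_V N)(a, c) = ∂_V N(a, c)
- D N(a, c) + N(D a, c) + N(a, D c)` (`lieDeriv_nijenhuis_eq`), so the second component is `D N(a,
c) + (L_V N)(a, c)`. This is the claimed formula. Since the image of `B` meets the vertical space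
only in zero, tangency amounts to the vanishing of the `C` part, and bump functions realise
arbitrary pairs of tangent vectors by smooth fields.

The remaining work is to show that `completeLift`, defined at each point through the chart preferred
there, has the expected matrix on a whole neighbourhood in one fixed chart of the tangent bundle
(`localEnd_completeLift`). -/

noncomputable section

namespace TangentLift

open Topology VectorField

/-! ### Vector fields, endomorphism fields and Lie brackets in a chart. -/

section LocalRepresentation

variable {E : Type*} [NormedAddCommGroup E] [NormedSpace ℝ E]
  {H : Type*} [TopologicalSpace H] (I : ModelWithCorners ℝ E H)
  {M : Type*} [TopologicalSpace M] [ChartedSpace H M] [IsManifold I ∞ M]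

/-- The tangent vector `X x`, as an element of the model space. -/
def modelVec (X : ∀ x : M, TangentSpace I x) (x : M) : E := X x

/-- The endomorphism `Φ x` of the tangent space, as an endomorphism of the model space. -/
def modelEnd (Φ : ∀ x : M, TangentSpace I x →L[ℝ] TangentSpace I x) (x : M) : E →L[ℝ] E := Φ x

/-- The components of the vector field `X` in the preferred chart at `x₀`. -/
def localField (X : ∀ x : M, TangentSpace I x) (x₀ : M) (e : E) : E :=
  tangentCoordChange I ((extChartAt I x₀).symm e) x₀ ((extChartAt I x₀).symm e)
    (modelVec I X ((extChartAt I x₀).symm e))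

/-- The matrix of the field of endomorphisms `Φ` in the preferred chart at `x₀`. -/
def localEnd (Φ : ∀ x : M, TangentSpace I x →L[ℝ] TangentSpace I x) (x₀ : M) (e : E) :
    E →L[ℝ] E :=
  inTangentCoordinates I I id id (fun z : M => Φ z) x₀ ((extChartAt I x₀).symm e)

theorem localEnd_apply (Φ : ∀ x : M, TangentSpace I x →L[ℝ] TangentSpace I x) {x₀ : M} {e : E}
    (he : e ∈ (extChartAt I x₀).target) (v : E) :
    localEnd I Φ x₀ e v =
      tangentCoordChange I ((extChartAt I x₀).symm e) x₀ ((extChartAt I x₀).symm e)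
        (modelEnd I Φ ((extChartAt I x₀).symm e)
          (tangentCoordChange I x₀ ((extChartAt I x₀).symm e) ((extChartAt I x₀).symm e) v)) := by
  have h : (extChartAt I x₀).symm e ∈ (chartAt H x₀).source := by
    rw [← extChartAt_source I]
    exact (extChartAt I x₀).map_target he
  exact congrArg (fun L : E →L[ℝ] E => L v)
    (inTangentCoordinates_eq (I := I) (I' := I) (fun z : M => z) (fun z : M => z)
      (modelEnd I Φ) (x₀ := x₀) h h)

theorem tangentCoordChange_comp_eq_id {x y z : M} (hx : z ∈ (extChartAt I x).source)
    (hy : z ∈ (extChartAt I y).source) (v : E) :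
    tangentCoordChange I y x z (tangentCoordChange I x y z v) = v := by
  rw [tangentCoordChange_comp ⟨⟨hx, hy⟩, hx⟩, tangentCoordChange_self hx]

theorem localField_apply_end (Φ : ∀ x : M, TangentSpace I x →L[ℝ] TangentSpace I x)
    (X : ∀ x : M, TangentSpace I x) {x₀ : M} {e : E} (he : e ∈ (extChartAt I x₀).target) :
    localField I (fun z => Φ z (X z)) x₀ e = localEnd I Φ x₀ e (localField I X x₀ e) := by
  rw [localEnd_apply I Φ he]
  have h := (extChartAt I x₀).map_target he
  unfold localField
  rw [tangentCoordChange_comp_eq_id I (mem_extChartAt_source _) h]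
  rfl

theorem localField_center (X : ∀ x : M, TangentSpace I x) (x₀ : M) :
    localField I X x₀ (extChartAt I x₀ x₀) = modelVec I X x₀ := by
  unfold localField
  rw [extChartAt_to_inv x₀]
  exact tangentCoordChange_self (mem_extChartAt_source x₀)

theorem localEnd_center (Φ : ∀ x : M, TangentSpace I x →L[ℝ] TangentSpace I x) (x₀ : M) :
    localEnd I Φ x₀ (extChartAt I x₀ x₀) = modelEnd I Φ x₀ := by
  refine ContinuousLinearMap.ext fun v => ?_
  rw [localEnd_apply I Φ (mem_extChartAt_target x₀), extChartAt_to_inv x₀,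
    tangentCoordChange_self (mem_extChartAt_source x₀),
    tangentCoordChange_self (mem_extChartAt_source x₀)]

/-- Mathlib's extension of the tangent vector `v` at `x₀` to a vector field. -/
def vectorExtension (x₀ : M) (v : E) (z : M) : TangentSpace I z :=
  FiberBundle.extend E (E := fun x : M => TangentSpace I x) (x := x₀) v z

/-- The extension is constant in the trivialization at `x₀`, whose inverse on fibres is the
coordinate change out of the chart at `x₀`. Hence derivatives of its components drop out of every
bracket below. -/
theorem localField_extend {x₀ : M} (v : E) {e : E} (he : e ∈ (extChartAt I x₀).target) :
    localField I (vectorExtension I x₀ v) x₀ e = v := by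
  have hs := (extChartAt I x₀).map_target he
  have h : (extChartAt I x₀).symm e ∈ (chartAt H x₀).source := by
    rwa [← extChartAt_source I]
  have h1 : modelVec I (vectorExtension I x₀ v)
        ((extChartAt I x₀).symm e) =
      tangentCoordChange I x₀ ((extChartAt I x₀).symm e) ((extChartAt I x₀).symm e) v := by
    have h2 : (trivializationAt E (TangentSpace I) x₀ ⟨x₀, v⟩).2 = v :=
      tangentCoordChange_self (I := I) (mem_extChartAt_source x₀)
    have h3 := congrArg (fun L => L v) (TangentBundle.symmL_trivializationAt_eq_core (I := I) h)
    refine Eq.trans ?_ h3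
    refine Eq.trans ?_ (Bundle.Trivialization.symmL_apply
      (R := ℝ) (trivializationAt E (TangentSpace I) x₀) h v).symm
    unfold modelVec vectorExtension FiberBundle.extend
    exact congrArg (fun w : E => ((trivializationAt E (TangentSpace I) x₀).symm
      ((extChartAt I x₀).symm e) w : E)) h2
  unfold localField
  rw [h1, tangentCoordChange_comp_eq_id I hs (mem_extChartAt_source _)]

theorem mfderivWithin_extChartAt_symm_eq {x₀ : M} {e : E} (he : e ∈ (extChartAt I x₀).target) :
    mfderivWithin 𝓘(ℝ, E) I (extChartAt I x₀).symm (Set.range I) e =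
      tangentCoordChange I x₀ ((extChartAt I x₀).symm e) ((extChartAt I x₀).symm e) := by
  have h : (extChartAt I x₀).symm e ∈ (chartAt H x₀).source := by
    rw [← extChartAt_source I]
    exact (extChartAt I x₀).map_target he
  have h1 := TangentBundle.symmL_trivializationAt (I := I) h
  rw [TangentBundle.symmL_trivializationAt_eq_core h, (extChartAt I x₀).right_inv he] at h1
  exact h1.symm

/-- The derivative of the inverse chart is a tangent coordinate change, so inverting it gives the
components. This links the manifold bracket, defined by pullback to a chart, with `localField`. -/
theorem mpullbackWithin_eq_localField (X : ∀ x : M, TangentSpace I x) {x₀ : M} {e : E}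
    (he : e ∈ (extChartAt I x₀).target) :
    mpullbackWithin 𝓘(ℝ, E) I (extChartAt I x₀).symm X (Set.range I) e = localField I X x₀ e := by
  have hs := (extChartAt I x₀).map_target he
  have inv := isInvertible_mfderivWithin_extChartAt_symm (I := I) he
  rw [mpullbackWithin_apply]
  refine inv.injective ((inv.self_apply_inverse _).trans ?_)
  refine Eq.trans ?_ (congrArg (fun L : E →L[ℝ] E => L (localField I X x₀ e))
    (mfderivWithin_extChartAt_symm_eq I he)).symm
  unfold localField
  exact (tangentCoordChange_comp_eq_id I (mem_extChartAt_source _) hs _).symm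

variable [I.Boundaryless]

/-- At the centre of the chart this is the definition of the bracket, so no differentiability is
needed. -/
theorem mlieBracket_eq_lieBracket_localField (X Y : ∀ x : M, TangentSpace I x) (x₀ : M) :
    mlieBracket I X Y x₀ =
      lieBracket ℝ (localField I X x₀) (localField I Y x₀) (extChartAt I x₀ x₀) := by
  have ht : (extChartAt I x₀).target ∈ 𝓝 (extChartAt I x₀ x₀) := extChartAt_target_mem_nhds x₀
  have hev : ∀ Z : ∀ x : M, TangentSpace I x,
      mpullbackWithin 𝓘(ℝ, E) I (extChartAt I x₀).symm Z (Set.range I)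
        =ᶠ[𝓝 (extChartAt I x₀ x₀)] localField I Z x₀ := fun Z => by
    filter_upwards [ht] with e he using mpullbackWithin_eq_localField I Z he
  rw [← mlieBracketWithin_univ, mlieBracketWithin_apply]
  -- The definition transports the bracket back by the derivative of the chart at its own centre,
  -- which is the identity.
  have hinv : ∀ (A : E →L[ℝ] E) (w : E), A = ContinuousLinearMap.id ℝ E → A.inverse w = w := by
    rintro A w rfl
    simp
  refine (hinv _ _ mfderiv_extChartAt_self).trans ?_
  rw [Set.preimage_univ, Set.univ_inter]
  have hr := hev X
  have hr' := hev Y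
  rw [I.range_eq_univ] at hr hr' ⊢
  exact (congrFun lieBracketWithin_univ _).trans (hr.lieBracket_vectorField_eq hr')

/-- Away from the centre the bracket is defined through another chart; naturality of the bracket
under pullback by the inverse chart bridges the two, at the price of differentiability of the
fields. -/
theorem localField_mlieBracket [CompleteSpace E] {X Y : ∀ x : M, TangentSpace I x} {x₀ : M} {e : E}
    (he : e ∈ (extChartAt I x₀).target)
    (hX : MDifferentiableAt I I.tangent (fun z => (⟨z, X z⟩ : TangentBundle I M))
      ((extChartAt I x₀).symm e))
    (hY : MDifferentiableAt I I.tangent (fun z => (⟨z, Y z⟩ : TangentBundle I M))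
      ((extChartAt I x₀).symm e)) :
    localField I (mlieBracket I X Y) x₀ e =
      lieBracket ℝ (localField I X x₀) (localField I Y x₀) e := by
  have : IsManifold I (minSmoothness ℝ 2) M := by
    rw [minSmoothness_of_isRCLikeNormedField]
    infer_instance
  have ht : (extChartAt I x₀).target ∈ 𝓝 e := (isOpen_extChartAt_target x₀).mem_nhds he
  have hev : ∀ Z : ∀ x : M, TangentSpace I x, ∀ e' ∈ (extChartAt I x₀).target,
      mpullback 𝓘(ℝ, E) I (extChartAt I x₀).symm Z e' = localField I Z x₀ e' := fun Z e' he' => by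
    have := mpullbackWithin_eq_localField I Z he'
    rwa [I.range_eq_univ, mpullbackWithin_univ] at this
  have hev' : ∀ Z : ∀ x : M, TangentSpace I x,
      mpullback 𝓘(ℝ, E) I (extChartAt I x₀).symm Z =ᶠ[𝓝 e] localField I Z x₀ := fun Z => by
    filter_upwards [ht] with e' he' using hev Z e' he'
  have hf : ContMDiffAt 𝓘(ℝ, E) I 2 (extChartAt I x₀).symm e :=
    (contMDiffOn_extChartAt_symm (I := I) (n := 2) x₀ e he).contMDiffAt ht
  have key := mpullback_mlieBracket (I := 𝓘(ℝ, E)) (I' := I) hX hY hf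
    (by rw [minSmoothness_of_isRCLikeNormedField])
  refine (hev _ e he).symm.trans (key.trans ?_)
  rw [← mlieBracketWithin_univ]
  refine (congrFun (mlieBracketWithin_eq_lieBracketWithin (𝕜 := ℝ) (E := E)) e).trans ?_
  exact (congrFun (lieBracketWithin_univ (𝕜 := ℝ) (E := E)) e).trans
    (Filter.EventuallyEq.lieBracket_vectorField_eq (𝕜 := ℝ) (E := E) (hev' X) (hev' Y))

theorem contMDiffAt_extChartAt_symm_center (x₀ : M) :
    ContMDiffAt 𝓘(ℝ, E) I ∞ (extChartAt I x₀).symm (extChartAt I x₀ x₀) :=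
  (contMDiffOn_extChartAt_symm (I := I) (n := ∞) x₀ _ (mem_extChartAt_target x₀)).contMDiffAt
    (extChartAt_target_mem_nhds x₀)

theorem IsSmoothVectorField.contDiffAt_localField {X : ∀ x : M, TangentSpace I x}
    (hX : IsSmoothVectorField I X) (x₀ : M) :
    ContDiffAt ℝ ∞ (localField I X x₀) (extChartAt I x₀ x₀) := by
  have h := (Bundle.contMDiffAt_section (IB := I) (F := E) (n := ∞) x₀).1 (hX x₀)
  have h' : ContMDiffAt I 𝓘(ℝ, E) ∞
      (fun z => tangentCoordChange I z x₀ z (modelVec I X z))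
      ((extChartAt I x₀).symm (extChartAt I x₀ x₀)) := by
    rw [extChartAt_to_inv x₀]
    exact h
  exact (h'.comp _ (contMDiffAt_extChartAt_symm_center I x₀)).contDiffAt

omit [I.Boundaryless] in
theorem IsSmoothEndField.contMDiffAt_inTangentCoordinates
    {Φ : ∀ x : M, TangentSpace I x →L[ℝ] TangentSpace I x}
    (hΦ : IsSmoothEndField I Φ) (x₀ : M) :
    ContMDiffAt I 𝓘(ℝ, E →L[ℝ] E) ∞
      (inTangentCoordinates I I id id (fun z : M => Φ z) x₀) x₀ :=
  ((contMDiffAt_hom_bundle _).1 (hΦ x₀)).2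

theorem IsSmoothEndField.contDiffAt_localEnd
    {Φ : ∀ x : M, TangentSpace I x →L[ℝ] TangentSpace I x}
    (hΦ : IsSmoothEndField I Φ) (x₀ : M) :
    ContDiffAt ℝ ∞ (localEnd I Φ x₀) (extChartAt I x₀ x₀) := by
  have h' : ContMDiffAt I 𝓘(ℝ, E →L[ℝ] E) ∞
      (inTangentCoordinates I I id id (fun z : M => Φ z) x₀)
      ((extChartAt I x₀).symm (extChartAt I x₀ x₀)) := by
    rw [extChartAt_to_inv x₀]
    exact hΦ.contMDiffAt_inTangentCoordinates I x₀
  exact (h'.comp _ (contMDiffAt_extChartAt_symm_center I x₀)).contDiffAt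

end LocalRepresentation

/-! ### The Nijenhuis tensor on a normed space. -/

section ModelSpace

variable {F : Type*} [NormedAddCommGroup F] [NormedSpace ℝ F]

/-- The Nijenhuis tensor of a field of endomorphisms of a normed space. -/
def modelNijenhuis (Φ : F → F →L[ℝ] F) (e v w : F) : F :=
  fderiv ℝ Φ e (Φ e v) w - fderiv ℝ Φ e (Φ e w) v
    + Φ e (fderiv ℝ Φ e w v) - Φ e (fderiv ℝ Φ e v w)

theorem modelNijenhuis_neg_left (Φ : F → F →L[ℝ] F) (e v w : F) :
    modelNijenhuis Φ e (-v) w = -modelNijenhuis Φ e v w := by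
  simp only [modelNijenhuis, map_neg, neg_apply]
  abel

theorem modelNijenhuis_neg_right (Φ : F → F →L[ℝ] F) (e v w : F) :
    modelNijenhuis Φ e v (-w) = -modelNijenhuis Φ e v w := by
  simp only [modelNijenhuis, map_neg, neg_apply]
  abel

theorem fderiv_clm_apply_const {G : Type*} [NormedAddCommGroup G] [NormedSpace ℝ G]
    {Φ : F → G →L[ℝ] G} {e : F} (hΦ : DifferentiableAt ℝ Φ e) (v : G) (h : F) :
    fderiv ℝ (fun e => Φ e v) e h = fderiv ℝ Φ e h v := by
  rw [fderiv_clm_apply hΦ (differentiableAt_const v)]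
  simp

theorem lieBracket_combination_eq_modelNijenhuis {Φ : F → F →L[ℝ] F} {e : F}
    (hΦ : DifferentiableAt ℝ Φ e) (v w : F) :
    lieBracket ℝ (fun e => Φ e v) (fun e => Φ e w) e
      - Φ e (lieBracket ℝ (fun e => Φ e v) (fun _ => w) e)
      - Φ e (lieBracket ℝ (fun _ => v) (fun e => Φ e w) e)
      + Φ e (Φ e (lieBracket ℝ (fun _ => v) (fun _ => w) e)) = modelNijenhuis Φ e v w := by
  simp only [lieBracket, fderiv_clm_apply_const hΦ, fderiv_fun_const, modelNijenhuis,
    Pi.zero_apply, zero_apply, zero_sub, sub_zero, map_neg, map_zero]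
  abel

end ModelSpace

/-! ### The Nijenhuis tensor and its Lie derivative in a chart. -/

section Nijenhuis

variable {E : Type*} [NormedAddCommGroup E] [NormedSpace ℝ E]
  {H : Type*} [TopologicalSpace H] (I : ModelWithCorners ℝ E H)
  {M : Type*} [TopologicalSpace M] [ChartedSpace H M] [IsManifold I ∞ M]

/-- The bracket identities are hypotheses because they have two sources: at the centre they hold by
definition, near the centre by naturality. -/
theorem localField_nijenhuisField_of_lieBracket
    {Φ : ∀ x : M, TangentSpace I x →L[ℝ] TangentSpace I x} {X Y : ∀ x : M, TangentSpace I x}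
    {x₀ : M} {e v w : E} (he : e ∈ (extChartAt I x₀).target)
    (hX : localField I X x₀ =ᶠ[𝓝 e] fun _ => v) (hY : localField I Y x₀ =ᶠ[𝓝 e] fun _ => w)
    (hΦX : localField I (fun z => Φ z (X z)) x₀ =ᶠ[𝓝 e] fun e' => localEnd I Φ x₀ e' v)
    (hΦY : localField I (fun z => Φ z (Y z)) x₀ =ᶠ[𝓝 e] fun e' => localEnd I Φ x₀ e' w)
    (hΦ : DifferentiableAt ℝ (localEnd I Φ x₀) e)
    (h₁ : localField I (mlieBracket I (fun z => Φ z (X z)) (fun z => Φ z (Y z))) x₀ e =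
      lieBracket ℝ (localField I (fun z => Φ z (X z)) x₀) (localField I (fun z => Φ z (Y z)) x₀) e)
    (h₂ : localField I (mlieBracket I (fun z => Φ z (X z)) Y) x₀ e =
      lieBracket ℝ (localField I (fun z => Φ z (X z)) x₀) (localField I Y x₀) e)
    (h₃ : localField I (mlieBracket I X (fun z => Φ z (Y z))) x₀ e =
      lieBracket ℝ (localField I X x₀) (localField I (fun z => Φ z (Y z)) x₀) e)
    (h₄ : localField I (mlieBracket I X Y) x₀ e =
      lieBracket ℝ (localField I X x₀) (localField I Y x₀) e) :
    localField I (nijenhuisField I Φ X Y) x₀ e = modelNijenhuis (localEnd I Φ x₀) e v w := by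
  rw [← lieBracket_combination_eq_modelNijenhuis hΦ]
  rw [hΦX.lieBracket_vectorField_eq hΦY] at h₁
  rw [hΦX.lieBracket_vectorField_eq hY] at h₂
  rw [hX.lieBracket_vectorField_eq hΦY] at h₃
  rw [hX.lieBracket_vectorField_eq hY] at h₄
  rw [← h₁, ← h₂, ← h₃, ← h₄, ← localField_apply_end I Φ _ he, ← localField_apply_end I Φ _ he,
    ← localField_apply_end I Φ _ he, ← localField_apply_end I Φ _ he]
  unfold localField
  rw [← map_sub, ← map_sub, ← map_add]
  rfl

variable [I.Boundaryless]

theorem localField_extend_eventuallyEq {x₀ : M} (v : E) {e : E}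
    (he : e ∈ (extChartAt I x₀).target) :
    localField I (vectorExtension I x₀ v) x₀
      =ᶠ[𝓝 e] fun _ => v := by
  filter_upwards [(isOpen_extChartAt_target x₀).mem_nhds he] with e' he'
  exact localField_extend I v he'

theorem localField_end_extend_eventuallyEq
    (Φ : ∀ x : M, TangentSpace I x →L[ℝ] TangentSpace I x) {x₀ : M} (v : E) {e : E}
    (he : e ∈ (extChartAt I x₀).target) :
    localField I (fun z => Φ z (vectorExtension I x₀ v z)) x₀
      =ᶠ[𝓝 e] fun e' => localEnd I Φ x₀ e' v := by
  filter_upwards [(isOpen_extChartAt_target x₀).mem_nhds he] with e' he'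
  rw [localField_apply_end I Φ _ he', localField_extend I v he']

/-- Only differentiability of the matrix at the centre is asked for, so this applies to the complete
lift without proving it smooth on the tangent bundle. -/
theorem nijenhuis_eq_modelNijenhuis (Φ : ∀ x : M, TangentSpace I x →L[ℝ] TangentSpace I x)
    (x₀ : M) (hΦ : DifferentiableAt ℝ (localEnd I Φ x₀) (extChartAt I x₀ x₀)) (v w : E) :
    nijenhuis I Φ x₀ v w =
      modelNijenhuis (localEnd I Φ x₀) (extChartAt I x₀ x₀) v w := by
  have he := mem_extChartAt_target (I := I) x₀
  have hb : ∀ X Y : ∀ x : M, TangentSpace I x,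
      localField I (mlieBracket I X Y) x₀ (extChartAt I x₀ x₀) =
      lieBracket ℝ (localField I X x₀) (localField I Y x₀) (extChartAt I x₀ x₀) := fun X Y =>
    (localField_center I _ x₀).trans (mlieBracket_eq_lieBracket_localField I X Y x₀)
  have := localField_nijenhuisField_of_lieBracket I (Φ := Φ) he
    (localField_extend_eventuallyEq I v he) (localField_extend_eventuallyEq I w he)
    (localField_end_extend_eventuallyEq I Φ v he) (localField_end_extend_eventuallyEq I Φ w he)
    hΦ (hb _ _) (hb _ _) (hb _ _) (hb _ _)
  exact (localField_center I _ x₀).symm.trans this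

/-- The Lie derivative differentiates the tensor, so its components are needed near the centre. At a
nearby point `nijenhuis` uses extensions based at that point; tensoriality (`nijenhuis_apply`)
replaces them by the extensions based at `x₀`. -/
theorem IsSmoothEndField.localField_nijenhuis_extend [FiniteDimensional ℝ E]
    {Φ : ∀ x : M, TangentSpace I x →L[ℝ] TangentSpace I x} (hΦ : IsSmoothEndField I Φ)
    (x₀ : M) (v w : E) :
    localField I (fun z => nijenhuis I Φ z
        (vectorExtension I x₀ v z)
        (vectorExtension I x₀ w z)) x₀
      =ᶠ[𝓝 (extChartAt I x₀ x₀)] fun e => modelNijenhuis (localEnd I Φ x₀) e v w := by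
  have : CompleteSpace E := FiniteDimensional.complete ℝ E
  have hext : ∀ v : E, ∀ᶠ e in 𝓝 (extChartAt I x₀ x₀), MDifferentiableAt I I.tangent
      (fun z => (⟨z, vectorExtension I x₀ v z⟩ :
        TangentBundle I M)) ((extChartAt I x₀).symm e) := fun v => by
    obtain ⟨s, hs, hsv⟩ := FiberBundle.exists_mdifferentiableOn_extend I E (V := TangentSpace I) (x₀ := x₀) v
    have h1 : ∀ᶠ z in 𝓝 x₀, MDifferentiableAt I I.tangent
        (fun z => (⟨z, vectorExtension I x₀ v z⟩ :
          TangentBundle I M)) z := by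
      filter_upwards [eventually_mem_nhds_iff.2 hs] with z hz
      exact (hsv z (mem_of_mem_nhds hz)).mdifferentiableAt hz
    have h2 := continuousAt_extChartAt_symm (I := I) x₀
    unfold ContinuousAt at h2
    rw [extChartAt_to_inv x₀] at h2
    exact h2.eventually h1
  have hdiff : ∀ᶠ e in 𝓝 (extChartAt I x₀ x₀), DifferentiableAt ℝ (localEnd I Φ x₀) e := by
    have h1 : ContDiffAt ℝ 1 (localEnd I Φ x₀) (extChartAt I x₀ x₀) :=
      (hΦ.contDiffAt_localEnd I x₀).of_le (by exact_mod_cast le_top)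
    filter_upwards [h1.eventually (by simp)] with e he using he.differentiableAt (by simp)
  have key : ∀ {σ : ∀ z : M, TangentSpace I z} {x : M},
      MDifferentiableAt I I.tangent (fun z => (⟨z, σ z⟩ : TangentBundle I M)) x →
      MDifferentiableAt I I.tangent (fun z => (⟨z, Φ z (σ z)⟩ : TangentBundle I M)) x :=
    fun {σ x} h => MDifferentiableAt.clm_bundle_apply (b := fun z : M => z) (v := σ)
      ((hΦ.mdifferentiable (by simp)) x) h
  filter_upwards [hext v, hext w, hdiff, extChartAt_target_mem_nhds (I := I) x₀]
    with e hv hw hd he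
  have := localField_nijenhuisField_of_lieBracket I (Φ := Φ) he
    (localField_extend_eventuallyEq I v he) (localField_extend_eventuallyEq I w he)
    (localField_end_extend_eventuallyEq I Φ v he) (localField_end_extend_eventuallyEq I Φ w he)
    hd (localField_mlieBracket I he (key hv) (key hw)) (localField_mlieBracket I he (key hv) hw)
    (localField_mlieBracket I he hv (key hw)) (localField_mlieBracket I he hv hw)
  refine Eq.trans ?_ this
  exact congrArg _ (nijenhuis_apply I Φ hΦ _ _ _ hv hw)

theorem IsSmoothEndField.lieDeriv_nijenhuis_eq [FiniteDimensional ℝ E]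
    {Φ : ∀ x : M, TangentSpace I x →L[ℝ] TangentSpace I x} (hΦ : IsSmoothEndField I Φ)
    (V : ∀ x : M, TangentSpace I x) (x₀ : M) (v w : E) :
    lieDeriv I V (nijenhuis I Φ) x₀ v
        w =
      fderiv ℝ (fun e => modelNijenhuis (localEnd I Φ x₀) e v w) (extChartAt I x₀ x₀)
          (modelVec I V x₀)
        - fderiv ℝ (localField I V x₀) (extChartAt I x₀ x₀)
          (modelNijenhuis (localEnd I Φ x₀) (extChartAt I x₀ x₀) v w)
        + modelNijenhuis (localEnd I Φ x₀) (extChartAt I x₀ x₀)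
          (fderiv ℝ (localField I V x₀) (extChartAt I x₀ x₀) v) w
        + modelNijenhuis (localEnd I Φ x₀) (extChartAt I x₀ x₀) v
          (fderiv ℝ (localField I V x₀) (extChartAt I x₀ x₀) w) := by
  have he := mem_extChartAt_target (I := I) x₀
  have hd : DifferentiableAt ℝ (localEnd I Φ x₀) (extChartAt I x₀ x₀) :=
    (hΦ.contDiffAt_localEnd I x₀).differentiableAt (by simp)
  -- The extension of `u` has constant components, so only the derivative of `V` survives, with a
  -- minus sign.
  have hbr : ∀ u : E, mlieBracket I V
      (vectorExtension I x₀ u) x₀ =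
      -fderiv ℝ (localField I V x₀) (extChartAt I x₀ x₀) u := fun u => by
    refine (mlieBracket_eq_lieBracket_localField I _ _ x₀).trans ?_
    refine ((Filter.EventuallyEq.refl _ _).lieBracket_vectorField_eq
      (localField_extend_eventuallyEq I u he)).trans ?_
    simp only [lieBracket, fderiv_fun_const, Pi.zero_apply, zero_apply, zero_sub]
  have h1 := (mlieBracket_eq_lieBracket_localField I V _ x₀).trans
    (Filter.EventuallyEq.lieBracket_vectorField_eq (𝕜 := ℝ) (E := E) (Filter.EventuallyEq.refl _ _)
      (hΦ.localField_nijenhuis_extend I x₀ v w))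
  have h2 := (congrArg (fun u : TangentSpace I x₀ => nijenhuis I Φ x₀ u w)
    (hbr v)).trans (nijenhuis_eq_modelNijenhuis I Φ x₀ hd _ w)
  have h3 := (congrArg (fun u : TangentSpace I x₀ => nijenhuis I Φ x₀ v u)
    (hbr w)).trans (nijenhuis_eq_modelNijenhuis I Φ x₀ hd v _)
  rw [modelNijenhuis_neg_left] at h2
  rw [modelNijenhuis_neg_right] at h3
  have h4 : ∀ a b c a' b' c' : E, a = a' → b = -b' → c = -c' → a - b - c = a' + b' + c' := by
    rintro a b c a' b' c' rfl rfl rfl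
    abel
  refine (h4 _ _ _ _ _ _ h1 h2 h3).trans ?_
  unfold lieBracket
  rw [localField_center]

end Nijenhuis

/-! ### Complete lifts on a normed space and their behaviour under transition maps. -/

section ModelLift

variable {F : Type*} [NormedAddCommGroup F] [NormedSpace ℝ F]

/-- The complete lift of a field of endomorphisms of a normed space `F` to `F × F`. -/
def modelCompleteLift (Φ : F → F →L[ℝ] F) (p : F × F) : F × F →L[ℝ] F × F :=
  ((Φ p.1).comp (ContinuousLinearMap.fst ℝ F F)).prod
    ((fderiv ℝ Φ p.1 p.2).comp (ContinuousLinearMap.fst ℝ F F)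
      + (Φ p.1).comp (ContinuousLinearMap.snd ℝ F F))

theorem modelCompleteLift_apply (Φ : F → F →L[ℝ] F) (p q : F × F) :
    modelCompleteLift Φ p q = (Φ p.1 q.1, fderiv ℝ Φ p.1 p.2 q.1 + Φ p.1 q.2) := rfl

theorem differentiableAt_modelCompleteLift {Φ : F → F →L[ℝ] F} {p : F × F}
    (hΦ : ContDiffAt ℝ 2 Φ p.1) : DifferentiableAt ℝ (modelCompleteLift Φ) p := by
  have h1 : DifferentiableAt ℝ (fun q : F × F => Φ q.1) p :=
    (hΦ.differentiableAt (by simp)).comp p differentiableAt_fst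
  have h2 : DifferentiableAt ℝ (fun q : F × F => fderiv ℝ Φ q.1) p :=
    ((hΦ.fderiv_right (m := 1) (by norm_num)).differentiableAt (by simp)).comp p
      differentiableAt_fst
  have h3 : DifferentiableAt ℝ (fun q : F × F => fderiv ℝ Φ q.1 q.2) p :=
    h2.clm_apply differentiableAt_snd
  have h4 : DifferentiableAt ℝ (fun q : F × F =>
      (fderiv ℝ Φ q.1 q.2).comp (ContinuousLinearMap.fst ℝ F F)
        + (Φ q.1).comp (ContinuousLinearMap.snd ℝ F F)) p :=
    (h3.clm_comp (differentiableAt_const _)).add (h1.clm_comp (differentiableAt_const _))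
  have h5 : DifferentiableAt ℝ (fun q : F × F =>
      (Φ q.1).comp (ContinuousLinearMap.fst ℝ F F)) p :=
    h1.clm_comp (differentiableAt_const _)
  -- Pairing two continuous linear maps is a linear isometry of the operator spaces, hence
  -- differentiable.
  have h6 : DifferentiableAt ℝ (fun L : (F × F →L[ℝ] F) × (F × F →L[ℝ] F) => L.1.prod L.2)
      ((Φ p.1).comp (ContinuousLinearMap.fst ℝ F F),
        (fderiv ℝ Φ p.1 p.2).comp (ContinuousLinearMap.fst ℝ F F)
          + (Φ p.1).comp (ContinuousLinearMap.snd ℝ F F)) :=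
    (ContinuousLinearMap.prodₗᵢ (𝕜 := ℝ) ℝ : ((F × F →L[ℝ] F) × (F × F →L[ℝ] F)) ≃ₗᵢ[ℝ]
      (F × F →L[ℝ] F × F)).toContinuousLinearEquiv.differentiableAt
  exact h6.comp p (h5.prodMk h4)

theorem fderiv_modelCompleteLift {Φ : F → F →L[ℝ] F} {e : F} (hΦ : ContDiffAt ℝ 2 Φ e)
    (y h k a b : F) :
    fderiv ℝ (modelCompleteLift Φ) (e, y) (h, k) (a, b) =
      (fderiv ℝ Φ e h a,
        fderiv ℝ (fderiv ℝ Φ) e h y a + fderiv ℝ Φ e k a + fderiv ℝ Φ e h b) := by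
  have hd := differentiableAt_modelCompleteLift (p := (e, y)) hΦ
  have hΦ1 : HasFDerivAt Φ (fderiv ℝ Φ e) (e, y).1 :=
    (hΦ.differentiableAt (by simp)).hasFDerivAt
  have hΦ2 : HasFDerivAt (fderiv ℝ Φ) (fderiv ℝ (fderiv ℝ Φ) e) (e, y).1 :=
    ((hΦ.fderiv_right (m := 1) (by norm_num)).differentiableAt (by simp)).hasFDerivAt
  have h1 := hΦ1.comp (e, y) (hasFDerivAt_fst (𝕜 := ℝ) (p := (e, y)))
  have h3 : HasFDerivAt (fun q : F × F => fderiv ℝ Φ q.1)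
      ((fderiv ℝ (fderiv ℝ Φ) e).comp (ContinuousLinearMap.fst ℝ F F)) (e, y) :=
    HasFDerivAt.comp (𝕜 := ℝ) (E := F × F) (F := F) (G := F →L[ℝ] F →L[ℝ] F)
      (g := fderiv ℝ Φ) (f := Prod.fst) (e, y) hΦ2 hasFDerivAt_fst
  have h2 := h3.clm_apply (hasFDerivAt_snd (𝕜 := ℝ) (p := (e, y)))
  have ha := hasFDerivAt_const (𝕜 := ℝ) a (e, y)
  have hb := hasFDerivAt_const (𝕜 := ℝ) b (e, y)
  have key : HasFDerivAt (fun q => modelCompleteLift Φ q (a, b)) _ (e, y) :=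
    (h1.clm_apply ha).prodMk ((h2.clm_apply ha).add (h1.clm_apply hb))
  have h4 : fderiv ℝ (modelCompleteLift Φ) (e, y) (h, k) (a, b) =
      fderiv ℝ (fun q => modelCompleteLift Φ q (a, b)) (e, y) (h, k) := by
    rw [fderiv_clm_apply hd (differentiableAt_const (a, b))]
    simp
  rw [h4, key.fderiv]
  simp [add_comm]

theorem fderiv_modelNijenhuis {Φ : F → F →L[ℝ] F} {e : F} (hΦ : ContDiffAt ℝ 2 Φ e)
    (a c y : F) :
    fderiv ℝ (fun e => modelNijenhuis Φ e a c) e y =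
      (fderiv ℝ (fderiv ℝ Φ) e y (Φ e a) c + fderiv ℝ Φ e (fderiv ℝ Φ e y a) c)
      - (fderiv ℝ (fderiv ℝ Φ) e y (Φ e c) a + fderiv ℝ Φ e (fderiv ℝ Φ e y c) a)
      + (fderiv ℝ Φ e y (fderiv ℝ Φ e c a) + Φ e (fderiv ℝ (fderiv ℝ Φ) e y c a))
      - (fderiv ℝ Φ e y (fderiv ℝ Φ e a c) + Φ e (fderiv ℝ (fderiv ℝ Φ) e y a c)) := by
  have h1 : HasFDerivAt Φ (fderiv ℝ Φ e) e := (hΦ.differentiableAt (by simp)).hasFDerivAt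
  have h2 : HasFDerivAt (fderiv ℝ Φ) (fderiv ℝ (fderiv ℝ Φ) e) e :=
    ((hΦ.fderiv_right (m := 1) (by norm_num)).differentiableAt (by simp)).hasFDerivAt
  have ha := hasFDerivAt_const (𝕜 := ℝ) a e
  have hc := hasFDerivAt_const (𝕜 := ℝ) c e
  have key : HasFDerivAt (fun e => modelNijenhuis Φ e a c) _ e :=
    ((((h2.clm_apply (h1.clm_apply ha)).clm_apply hc).sub
      ((h2.clm_apply (h1.clm_apply hc)).clm_apply ha)).add
      (h1.clm_apply ((h2.clm_apply hc).clm_apply ha))).sub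
      (h1.clm_apply ((h2.clm_apply ha).clm_apply hc))
  rw [key.fderiv]
  simp only [add_apply, sub_apply, ContinuousLinearMap.comp_apply, ContinuousLinearMap.flip_apply,
    zero_apply, map_zero, zero_add]
  abel

/-- The fibre component is the derivative of `N(a, c)` along `(y, b, d)`. Expanding both sides by
the product rule, they agree once `y` is moved to the same slot of every second derivative of `Φ`.
-/
theorem modelNijenhuis_modelCompleteLift {Φ : F → F →L[ℝ] F} {e : F} (hΦ : ContDiffAt ℝ 2 Φ e)
    (y a b c d : F) :
    modelNijenhuis (modelCompleteLift Φ) (e, y) (a, b) (c, d) =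
      (modelNijenhuis Φ e a c,
        fderiv ℝ (fun e => modelNijenhuis Φ e a c) e y
          + modelNijenhuis Φ e a d + modelNijenhuis Φ e b c) := by
  have hsymm : ∀ h k, fderiv ℝ (fderiv ℝ Φ) e h k = fderiv ℝ (fderiv ℝ Φ) e k h := fun h k =>
    (hΦ.isSymmSndFDerivAt (by simp)).eq h k
  rw [fderiv_modelNijenhuis hΦ]
  simp only [modelNijenhuis, modelCompleteLift_apply, fderiv_modelCompleteLift hΦ, map_add,
    add_apply, hsymm y]
  ext
  · simp
  · simp only [Prod.snd_add, Prod.snd_sub]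
    abel

/-- The derivative of a transition map `τ`, as a transition map of tangent bundle charts. -/
theorem hasFDerivAt_tangent_transition {τ : F → F} {e : F} (hτ : ContDiffAt ℝ 2 τ e) (y : F) :
    HasFDerivAt (fun p : F × F => (τ p.1, fderiv ℝ τ p.1 p.2))
      (((fderiv ℝ τ e).comp (ContinuousLinearMap.fst ℝ F F)).prod
        ((((fderiv ℝ (fderiv ℝ τ) e).flip y).comp (ContinuousLinearMap.fst ℝ F F))
          + (fderiv ℝ τ e).comp (ContinuousLinearMap.snd ℝ F F))) (e, y) := by
  have h1 : HasFDerivAt τ (fderiv ℝ τ e) (e, y).1 :=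
    (hτ.differentiableAt (by simp)).hasFDerivAt
  have h2 : HasFDerivAt (fderiv ℝ τ) (fderiv ℝ (fderiv ℝ τ) e) (e, y).1 :=
    ((hτ.fderiv_right (m := 1) (by norm_num)).differentiableAt (by simp)).hasFDerivAt
  have h3 := (h2.comp (e, y) (hasFDerivAt_fst (𝕜 := ℝ) (p := (e, y)))).clm_apply
    (hasFDerivAt_snd (𝕜 := ℝ) (p := (e, y)))
  refine ((h1.comp (e, y) (hasFDerivAt_fst (𝕜 := ℝ) (p := (e, y)))).prodMk h3).congr_fderiv ?_
  refine ContinuousLinearMap.ext fun q => ?_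
  simp [add_comm]

/-- The complete lift of a tensor field is compatible with changes of coordinates. -/
theorem modelCompleteLift_transition {Φ Φ' : F → F →L[ℝ] F} {τ : F → F} {e : F}
    (hτ : ContDiffAt ℝ 2 τ e) (hΦ : DifferentiableAt ℝ Φ e) (hΦ' : DifferentiableAt ℝ Φ' (τ e))
    (h : ∀ᶠ e' in 𝓝 e, ∀ v, Φ' (τ e') (fderiv ℝ τ e' v) = fderiv ℝ τ e' (Φ e' v)) (y : F)
    (q : F × F) :
    fderiv ℝ (fun p : F × F => (τ p.1, fderiv ℝ τ p.1 p.2)) (e, y)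
        (modelCompleteLift Φ (e, y) q) =
      modelCompleteLift Φ' (τ e, fderiv ℝ τ e y)
        (fderiv ℝ (fun p : F × F => (τ p.1, fderiv ℝ τ p.1 p.2)) (e, y) q) := by
  obtain ⟨a, b⟩ := q
  have h1 : HasFDerivAt τ (fderiv ℝ τ e) e := (hτ.differentiableAt (by simp)).hasFDerivAt
  have h2 : HasFDerivAt (fderiv ℝ τ) (fderiv ℝ (fderiv ℝ τ) e) e :=
    ((hτ.fderiv_right (m := 1) (by norm_num)).differentiableAt (by simp)).hasFDerivAt
  have hsymm : ∀ h k, fderiv ℝ (fderiv ℝ τ) e h k = fderiv ℝ (fderiv ℝ τ) e k h := fun h k =>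
    (hτ.isSymmSndFDerivAt (by simp)).eq h k
  have ha := hasFDerivAt_const (𝕜 := ℝ) a e
  have hl := (hΦ'.hasFDerivAt.comp e h1).clm_apply (h2.clm_apply ha)
  have hr := h2.clm_apply (hΦ.hasFDerivAt.clm_apply ha)
  have heq : (fun e' => Φ' (τ e') (fderiv ℝ τ e' a)) =ᶠ[𝓝 e]
      fun e' => fderiv ℝ τ e' (Φ e' a) := h.mono fun e' he' => he' a
  -- The intertwining relation, on the fixed vector `a`, is differentiated in the direction `y`;
  -- this is the fibre component of the claim up to symmetry of the second derivative of `τ`.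
  have hd := congrArg (fun L : F →L[ℝ] F => L y) ((hl.congr_of_eventuallyEq heq.symm).unique hr)
  simp only [add_apply, ContinuousLinearMap.comp_apply, ContinuousLinearMap.flip_apply,
    zero_apply, map_zero, zero_add] at hd
  have he := h.self_of_nhds
  rw [(hasFDerivAt_tangent_transition hτ y).fderiv]
  simp only [modelCompleteLift_apply, ContinuousLinearMap.prod_apply, add_apply,
    ContinuousLinearMap.comp_apply, ContinuousLinearMap.flip_apply, ContinuousLinearMap.coe_fst',
    ContinuousLinearMap.coe_snd', map_add, he, Prod.mk.injEq, true_and]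
  rw [hsymm a y, hsymm (Φ e a) y]
  simp only [Function.comp_apply] at hd
  rw [← add_assoc, ← add_assoc]
  congr 1
  rw [add_comm, ← hd]
  abel

end ModelLift

/-! ### The complete lift in a fixed chart of the tangent bundle. -/

section CompleteLift

variable {E : Type*} [NormedAddCommGroup E] [NormedSpace ℝ E]
  {H : Type*} [TopologicalSpace H] (I : ModelWithCorners ℝ E H)
  {M : Type*} [TopologicalSpace M] [ChartedSpace H M] [IsManifold I ∞ M]

/-- The fibre component of a point of the tangent bundle, as an element of the model space. -/
def fibreVec (u : TangentBundle I M) : E := u.snd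

theorem extChartAt_tangent_apply (u₀ u : TangentBundle I M) :
    extChartAt I.tangent u₀ u = (extChartAt I u₀.proj u.proj,
      tangentCoordChange I u.proj u₀.proj u.proj (fibreVec I u)) := rfl

theorem mem_extChartAt_tangent_source {u₀ u : TangentBundle I M} :
    u ∈ (extChartAt I.tangent u₀).source ↔ u.proj ∈ (extChartAt I u₀.proj).source := by
  rw [extChartAt_source, extChartAt_source]
  exact TangentBundle.mem_chart_source_iff u u₀

theorem extChartAt_tangent_symm_proj {u₀ : TangentBundle I M} {p : E × E}
    (hp : p ∈ (extChartAt I.tangent u₀).target) :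
    ((extChartAt I.tangent u₀).symm p).proj = (extChartAt I u₀.proj).symm p.1 := by
  have h := (extChartAt I.tangent u₀).right_inv hp
  have hs := (mem_extChartAt_tangent_source I).1 ((extChartAt I.tangent u₀).map_target hp)
  rw [extChartAt_tangent_apply] at h
  have h1 := congrArg Prod.fst h
  conv_rhs => rw [← h1]
  exact ((extChartAt I u₀.proj).left_inv hs).symm

theorem fst_mem_of_mem_extChartAt_tangent_target {u₀ : TangentBundle I M} {p : E × E}
    (hp : p ∈ (extChartAt I.tangent u₀).target) : p.1 ∈ (extChartAt I u₀.proj).target := by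
  have h := (extChartAt I.tangent u₀).right_inv hp
  have hs := (mem_extChartAt_tangent_source I).1 ((extChartAt I.tangent u₀).map_target hp)
  rw [extChartAt_tangent_apply] at h
  rw [← h]
  exact (extChartAt I u₀.proj).map_source hs

theorem fibreVec_extChartAt_tangent_symm {u₀ : TangentBundle I M} {p : E × E}
    (hp : p ∈ (extChartAt I.tangent u₀).target) :
    fibreVec I ((extChartAt I.tangent u₀).symm p) =
      tangentCoordChange I u₀.proj ((extChartAt I.tangent u₀).symm p).proj
        ((extChartAt I.tangent u₀).symm p).proj p.2 := by
  have h := (extChartAt I.tangent u₀).right_inv hp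
  have hs := (mem_extChartAt_tangent_source I).1 ((extChartAt I.tangent u₀).map_target hp)
  rw [extChartAt_tangent_apply] at h
  have h2 := congrArg Prod.snd h
  conv_rhs => rw [← h2]
  exact (tangentCoordChange_comp_eq_id I (mem_extChartAt_source _) hs _).symm

variable [I.Boundaryless]

theorem fderiv_transition_eq {x₀ x : M} {e : E} (he : e ∈ (extChartAt I x₀).target) :
    fderiv ℝ (extChartAt I x ∘ (extChartAt I x₀).symm) e =
      tangentCoordChange I x₀ x ((extChartAt I x₀).symm e) := by
  rw [tangentCoordChange_def, I.range_eq_univ, fderivWithin_univ, (extChartAt I x₀).right_inv he]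

theorem contDiffAt_transition {x₀ x : M} {e : E} (he : e ∈ (extChartAt I x₀).target)
    (hx : (extChartAt I x₀).symm e ∈ (extChartAt I x).source) :
    ContDiffAt ℝ 2 (extChartAt I x ∘ (extChartAt I x₀).symm) e := by
  have h : e ∈ ((extChartAt I x₀).symm ≫ extChartAt I x).source := ⟨he, hx⟩
  have := contDiffWithinAt_ext_coord_change (I := I) (n := 2) x x₀ h
  rwa [I.range_eq_univ, contDiffWithinAt_univ] at this

omit [IsManifold I ∞ M] in
theorem eventually_mem_transition_source {x₀ x : M} {e : E} (he : e ∈ (extChartAt I x₀).target)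
    (hx : (extChartAt I x₀).symm e ∈ (extChartAt I x).source) :
    ∀ᶠ e' in 𝓝 e, e' ∈ (extChartAt I x₀).target ∧
      (extChartAt I x₀).symm e' ∈ (extChartAt I x).source := by
  refine Filter.Eventually.and ((isOpen_extChartAt_target x₀).mem_nhds he) ?_
  exact (continuousAt_extChartAt_symm'' he).preimage_mem_nhds
    ((isOpen_extChartAt_source x).mem_nhds hx)

theorem localEnd_transition (Ψ : ∀ x : M, TangentSpace I x →L[ℝ] TangentSpace I x) {x₀ x : M}
    {e : E} (he : e ∈ (extChartAt I x₀).target)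
    (hx : (extChartAt I x₀).symm e ∈ (extChartAt I x).source) (v : E) :
    localEnd I Ψ x ((extChartAt I x ∘ (extChartAt I x₀).symm) e)
        (fderiv ℝ (extChartAt I x ∘ (extChartAt I x₀).symm) e v) =
      fderiv ℝ (extChartAt I x ∘ (extChartAt I x₀).symm) e (localEnd I Ψ x₀ e v) := by
  have hs := (extChartAt I x₀).map_target he
  have hc := mem_extChartAt_source (I := I) ((extChartAt I x₀).symm e)
  rw [Function.comp_apply, localEnd_apply I Ψ ((extChartAt I x).map_source hx),
    localEnd_apply I Ψ he, (extChartAt I x).left_inv hx, fderiv_transition_eq I he,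
    tangentCoordChange_comp ⟨⟨hs, hx⟩, hc⟩, tangentCoordChange_comp ⟨⟨hc, hs⟩, hx⟩]

/-- Transition maps of the tangent bundle are the tangent maps of those of `M`; this gives the
equality near `p`, which is then differentiated. -/
theorem tangentCoordChange_tangent_eq {u₀ : TangentBundle I M} {p : E × E}
    (hp : p ∈ (extChartAt I.tangent u₀).target) (u : TangentBundle I M)
    (hu : u = (extChartAt I.tangent u₀).symm p) :
    tangentCoordChange I.tangent u₀ u u =
      fderiv ℝ (fun q : E × E =>
        ((extChartAt I u.proj ∘ (extChartAt I u₀.proj).symm) q.1,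
          fderiv ℝ (extChartAt I u.proj ∘ (extChartAt I u₀.proj).symm) q.1 q.2)) p := by
  have he := fst_mem_of_mem_extChartAt_tangent_target I hp
  have hx : (extChartAt I u₀.proj).symm p.1 ∈ (extChartAt I u.proj).source := by
    rw [← extChartAt_tangent_symm_proj I hp, ← hu]
    exact mem_extChartAt_source _
  rw [tangentCoordChange_def, I.tangent.range_eq_univ, fderivWithin_univ]
  conv_lhs => rw [hu, (extChartAt I.tangent u₀).right_inv hp, ← hu]
  refine Filter.EventuallyEq.fderiv_eq ?_
  filter_upwards [continuousAt_fst.eventually (eventually_mem_transition_source I he hx),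
    (isOpen_extChartAt_target (I := I.tangent) u₀).mem_nhds hp] with q hq hq'
  rw [Function.comp_apply, extChartAt_tangent_apply, fibreVec_extChartAt_tangent_symm I hq',
    extChartAt_tangent_symm_proj I hq', fderiv_transition_eq I hq.1,
    tangentCoordChange_comp ⟨⟨(extChartAt I u₀.proj).map_target hq.1, mem_extChartAt_source _⟩,
      hq.2⟩]
  rfl

theorem IsSmoothEndField.modelEnd_completeLift
    {Ψ : ∀ x : M, TangentSpace I x →L[ℝ] TangentSpace I x} (hΨ : IsSmoothEndField I Ψ)
    (u : TangentBundle I M) :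
    modelEnd I.tangent (completeLift I Ψ) u =
      modelCompleteLift (localEnd I Ψ u.proj) (extChartAt I u.proj u.proj, fibreVec I u) := by
  have hd : (mfderiv I 𝓘(ℝ, E →L[ℝ] E)
      (fun z : M => inTangentCoordinates I I id id (fun z : M => Ψ z) u.proj z) u.proj :
        E →L[ℝ] E →L[ℝ] E) =
      fderiv ℝ (localEnd I Ψ u.proj) (extChartAt I u.proj u.proj) := by
    have h := (hΨ.contMDiffAt_inTangentCoordinates I u.proj).mdifferentiableAt (by simp)
    rw [h.mfderiv, I.range_eq_univ, fderivWithin_univ]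
    rfl
  refine ContinuousLinearMap.ext fun q => ?_
  rw [modelCompleteLift_apply, localEnd_center, ← hd]
  rfl

/-- The lift at a point `u` near `u₀` is a model lift in the chart preferred at `u`. Carrying it to
the chart at `u₀` is `modelCompleteLift_transition`, applied to the transition map between the base
charts. -/
theorem IsSmoothEndField.localEnd_completeLift
    {Ψ : ∀ x : M, TangentSpace I x →L[ℝ] TangentSpace I x} (hΨ : IsSmoothEndField I Ψ)
    {u₀ : TangentBundle I M} {p : E × E} (hp : p ∈ (extChartAt I.tangent u₀).target)
    (hd : DifferentiableAt ℝ (localEnd I Ψ u₀.proj) p.1) :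
    localEnd I.tangent (completeLift I Ψ) u₀ p = modelCompleteLift (localEnd I Ψ u₀.proj) p := by
  refine ContinuousLinearMap.ext fun q => ?_
  rw [localEnd_apply I.tangent _ hp]
  have hus := (extChartAt I.tangent u₀).map_target hp
  have hproj := extChartAt_tangent_symm_proj I hp
  have hvec := fibreVec_extChartAt_tangent_symm I hp
  have hcc := tangentCoordChange_tangent_eq I hp _ rfl
  -- The target chart depends on this point, so it becomes a variable once its base point, its fibre
  -- part and the coordinate change are recorded.
  generalize (extChartAt I.tangent u₀).symm p = u at *
  have he := fst_mem_of_mem_extChartAt_tangent_target I hp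
  have hx : (extChartAt I u₀.proj).symm p.1 ∈ (extChartAt I u.proj).source := by
    rw [← hproj]
    exact mem_extChartAt_source _
  have hτ := contDiffAt_transition I he hx
  have hτe : (extChartAt I u.proj ∘ (extChartAt I u₀.proj).symm) p.1 =
      extChartAt I u.proj u.proj := by
    rw [Function.comp_apply, ← hproj]
  have hd' : DifferentiableAt ℝ (localEnd I Ψ u.proj)
      ((extChartAt I u.proj ∘ (extChartAt I u₀.proj).symm) p.1) := by
    rw [hτe]
    exact (hΨ.contDiffAt_localEnd I u.proj).differentiableAt (by simp)
  have key := modelCompleteLift_transition hτ hd hd'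
    ((eventually_mem_transition_source I he hx).mono fun e' he' v =>
      localEnd_transition I Ψ he'.1 he'.2 v) p.2 q
  rw [fderiv_transition_eq I he, ← hproj, ← hvec, hτe, Prod.mk.eta, ← hcc] at key
  rw [hΨ.modelEnd_completeLift, ← key]
  exact tangentCoordChange_comp_eq_id I.tangent hus (mem_extChartAt_source _) _

end CompleteLift

/-! ### Restriction to the cross-section and the tangency criterion. -/

section CrossSection

variable {E : Type*} [NormedAddCommGroup E] [NormedSpace ℝ E]
  {H : Type*} [TopologicalSpace H] (I : ModelWithCorners ℝ E H)
  {M : Type*} [TopologicalSpace M] [ChartedSpace H M] [IsManifold I ∞ M]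

theorem modelNijenhuis_congr {F : Type*} [NormedAddCommGroup F] [NormedSpace ℝ F]
    {Φ Φ' : F → F →L[ℝ] F} {e : F} (h : Φ =ᶠ[𝓝 e] Φ') (v w : F) :
    modelNijenhuis Φ e v w = modelNijenhuis Φ' e v w := by
  unfold modelNijenhuis
  rw [h.fderiv_eq, h.self_of_nhds]

theorem extChartAt_tangent_crossSection (V : ∀ x : M, TangentSpace I x) (x : M) :
    extChartAt I.tangent (crossSection I V x) (crossSection I V x) =
      (extChartAt I x x, modelVec I V x) :=
  congrArg (Prod.mk _) (tangentCoordChange_self (mem_extChartAt_source x))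

variable [I.Boundaryless]

/-- In the charts at `x` and at `(x, V x)` the cross-section is the graph map of the components of
`V`. -/
theorem IsSmoothVectorField.liftB_apply {V : ∀ x : M, TangentSpace I x}
    (hV : IsSmoothVectorField I V) (x : M) (v : E) :
    liftB I V x v = (v, fderiv ℝ (localField I V x) (extChartAt I x x) v) := by
  have hm : MDifferentiableAt I I.tangent (crossSection I V) x :=
    (hV x).mdifferentiableAt (by simp)
  have hd : DifferentiableAt ℝ (localField I V x) (extChartAt I x x) :=
    (hV.contDiffAt_localField I x).differentiableAt (by simp)
  have heq : writtenInExtChartAt I I.tangent x (crossSection I V) =ᶠ[𝓝 (extChartAt I x x)]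
      fun e => (e, localField I V x e) := by
    filter_upwards [extChartAt_target_mem_nhds (I := I) x] with e he
    exact congrArg (fun e' : E => (e', localField I V x e)) ((extChartAt I x).right_inv he)
  have h : (liftB I V x : E →L[ℝ] E × E) =
      fderiv ℝ (fun e => (e, localField I V x e)) (extChartAt I x x) := by
    rw [← heq.fderiv_eq, ← fderivWithin_univ, ← I.range_eq_univ]
    exact hm.mfderiv
  refine (congrArg (fun L : E →L[ℝ] E × E => L v) h).trans ?_
  have := (hasFDerivAt_id (𝕜 := ℝ) (extChartAt I x x)).prodMk hd.hasFDerivAt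
  exact congrArg (fun L : E →L[ℝ] E × E => L v) this.fderiv

theorem IsSmoothEndField.nijenhuis_completeLift_liftB [FiniteDimensional ℝ E]
    {Ψ : ∀ x : M, TangentSpace I x →L[ℝ] TangentSpace I x} (hΨ : IsSmoothEndField I Ψ)
    {V : ∀ x : M, TangentSpace I x} (hV : IsSmoothVectorField I V) (x : M)
    (v w : E) :
    nijenhuis I.tangent (completeLift I Ψ) (crossSection I V x) (liftB I V x v) (liftB I V x w) =
      liftB I V x (nijenhuis I Ψ x v w) + liftC I V x (lieDeriv I V (nijenhuis I Ψ) x v w) := by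
  set e₀ := extChartAt I x x with he₀
  set D := fderiv ℝ (localField I V x) e₀ with hD
  have hΨ2 : ContDiffAt ℝ 2 (localEnd I Ψ x) e₀ :=
    contDiffAt_infty.1 (hΨ.contDiffAt_localEnd I x) 2
  have hΨd : DifferentiableAt ℝ (localEnd I Ψ x) e₀ := hΨ2.differentiableAt (by simp)
  have hcenter := extChartAt_tangent_crossSection I V x
  have heq : localEnd I.tangent (completeLift I Ψ) (crossSection I V x)
      =ᶠ[𝓝 (extChartAt I.tangent (crossSection I V x) (crossSection I V x))]
      modelCompleteLift (localEnd I Ψ x) := by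
    have h1 : ∀ᶠ e in 𝓝 e₀, DifferentiableAt ℝ (localEnd I Ψ x) e :=
      (hΨ2.eventually (by simp)).mono fun e he => he.differentiableAt (by simp)
    have h2 : ∀ᶠ p : E × E in
        𝓝 (extChartAt I.tangent (crossSection I V x) (crossSection I V x)),
        DifferentiableAt ℝ (localEnd I Ψ x) p.1 := by
      rw [hcenter]
      exact continuousAt_fst.eventually h1
    filter_upwards [h2, extChartAt_target_mem_nhds (I := I.tangent) (crossSection I V x)]
      with p hp hpt using hΨ.localEnd_completeLift I hpt hp
  have hN := nijenhuis_eq_modelNijenhuis I.tangent (completeLift I Ψ) (crossSection I V x)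
    (heq.differentiableAt_iff.2 (by
      rw [hcenter]
      exact differentiableAt_modelCompleteLift hΨ2)) (v, D v) (w, D w)
  rw [modelNijenhuis_congr heq, hcenter, modelNijenhuis_modelCompleteLift hΨ2] at hN
  have hNx := nijenhuis_eq_modelNijenhuis I Ψ x hΨd v w
  have hL := hΨ.lieDeriv_nijenhuis_eq I V x v w
  have hl : nijenhuis I.tangent (completeLift I Ψ) (crossSection I V x)
      (liftB I V x v) (liftB I V x w) =
      nijenhuis I.tangent (completeLift I Ψ) (crossSection I V x) (v, D v) (w, D w) :=
    congrArg₂ (nijenhuis I.tangent (completeLift I Ψ) (crossSection I V x))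
      (hV.liftB_apply I x v) (hV.liftB_apply I x w)
  refine hl.trans (hN.trans ?_)
  have hr : ∀ (n l : E), (liftB I V x n + liftC I V x l : E × E) = (n, D n + l) := fun n l => by
    refine (congrArg (fun q : E × E => q + ((0, l) : E × E)) (hV.liftB_apply I x n)).trans ?_
    simp [hD, he₀]
  refine Eq.trans ?_ (hr _ _).symm
  -- The base components agree. In the fibre, `D N(v, w)` coming from `B` cancels the term `-D N(v,
  -- w)` of the Lie derivative.
  refine Prod.ext hNx.symm ?_
  refine Eq.trans ?_ (congrArg₂ (fun n l : E => D n + l) hNx hL).symm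
  simp only [← he₀, ← hD]
  abel

theorem IsSmoothVectorField.isTangentToCrossSection_liftB_add_liftC
    {V : ∀ x : M, TangentSpace I x} (hV : IsSmoothVectorField I V) (x : M)
    (v w : TangentSpace I x) :
    IsTangentToCrossSection I V x (liftB I V x v + liftC I V x w) ↔ w = 0 := by
  constructor
  · rintro ⟨u, hu⟩
    have hu' : liftB I V x (u - v) = liftC I V x w := by
      rw [map_sub, sub_eq_iff_eq_add']
      exact hu
    have h := (hV.liftB_apply I x (u - v)).symm.trans hu'
    -- A vertical vector has zero base component, while `B` preserves the base component.
    have h1 : (u - v : E) = 0 := congrArg Prod.fst h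
    have h2 : fderiv ℝ (localField I V x) (extChartAt I x x) (u - v : E) = w :=
      congrArg Prod.snd h
    exact h2.symm.trans ((congrArg (fderiv ℝ (localField I V x) (extChartAt I x x)) h1).trans
      (map_zero _))
  · rintro rfl
    exact ⟨v, by rw [map_zero, add_zero]; rfl⟩

theorem IsSmoothEndField.isTangentToCrossSection_nijenhuis_iff [FiniteDimensional ℝ E]
    {Ψ : ∀ x : M, TangentSpace I x →L[ℝ] TangentSpace I x} (hΨ : IsSmoothEndField I Ψ)
    {V : ∀ x : M, TangentSpace I x} (hV : IsSmoothVectorField I V) (x : M)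
    (v w : TangentSpace I x) :
    IsTangentToCrossSection I V x (nijenhuis I.tangent (completeLift I Ψ) (crossSection I V x)
        (liftB I V x v) (liftB I V x w)) ↔
      lieDeriv I V (nijenhuis I Ψ) x v w = 0 :=
  (congrArg (IsTangentToCrossSection I V x)
    (hΨ.nijenhuis_completeLift_liftB I hV x v w)).to_iff.trans
    (hV.isTangentToCrossSection_liftB_add_liftC I x _ _)

omit [I.Boundaryless] in
-- Mathlib's extension is smooth only near `x`; multiplying by a bump function supported there, with
-- value one at `x`, makes it globally smooth. This turns the condition on fields into one on
-- tangent vectors.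
theorem exists_isSmoothVectorField_eq [FiniteDimensional ℝ E] [T2Space M] (x : M)
    (v : TangentSpace I x) :
    ∃ X : ∀ x : M, TangentSpace I x, IsSmoothVectorField I X ∧ X x = v := by
  obtain ⟨s, hs, hsv⟩ := FiberBundle.exists_contMDiffOn_extend (k := ∞) I E v
  obtain ⟨f, hf, -⟩ := (SmoothBumpFunction.nhds_basis_support (I := I)
    (interior_mem_nhds.2 hs)).mem_iff.1 (interior_mem_nhds.2 hs)
  refine ⟨fun z => f z • FiberBundle.extend E v z, ?_, ?_⟩
  · exact ContMDiffOn.smul_section_of_tsupport f.contMDiff.contMDiffOn isOpen_interior hf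
      (hsv.mono interior_subset)
  · simp only [FiberBundle.extend_apply_self, SmoothBumpFunction.eq_one, one_smul]

end CrossSection

end TangentLift

end

theorem theorem6p3
    {E : Type*} [NormedAddCommGroup E] [NormedSpace ℝ E] [FiniteDimensional ℝ E]
    {H : Type*} [TopologicalSpace H] (I : ModelWithCorners ℝ E H) [I.Boundaryless]
    {M : Type*} [TopologicalSpace M] [T2Space M] [ChartedSpace H M] [IsManifold I ∞ M]
    (Ψ : ∀ x : M, TangentSpace I x →L[ℝ] TangentSpace I x)
    (hΨ : TangentLift.IsSmoothEndField I Ψ)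
    (V : ∀ x : M, TangentSpace I x) (hV : TangentLift.IsSmoothVectorField I V) :
    (∀ X Y : ∀ x : M, TangentSpace I x,
      TangentLift.IsSmoothVectorField I X → TangentLift.IsSmoothVectorField I Y →
      ∀ x : M,
        TangentLift.nijenhuis I.tangent (TangentLift.completeLift I Ψ)
            (TangentLift.crossSection I V x)
            (TangentLift.liftB I V x (X x)) (TangentLift.liftB I V x (Y x))
          = TangentLift.liftB I V x (TangentLift.nijenhuis I Ψ x (X x) (Y x))
            + TangentLift.liftC I V x
                (TangentLift.lieDeriv I V (TangentLift.nijenhuis I Ψ) x (X x) (Y x))) ∧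
    ((∀ X Y : ∀ x : M, TangentSpace I x,
      TangentLift.IsSmoothVectorField I X → TangentLift.IsSmoothVectorField I Y →
      ∀ x : M,
        TangentLift.IsTangentToCrossSection I V x
          (TangentLift.nijenhuis I.tangent (TangentLift.completeLift I Ψ)
            (TangentLift.crossSection I V x)
            (TangentLift.liftB I V x (X x)) (TangentLift.liftB I V x (Y x)))) ↔
      ∀ (x : M) (v w : TangentSpace I x),
        TangentLift.lieDeriv I V (TangentLift.nijenhuis I Ψ) x v w = 0) := by
  refine ⟨fun X Y _ _ x => hΨ.nijenhuis_completeLift_liftB I hV x (X x) (Y x),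
    fun h x v w => ?_, fun h X Y _ _ x => ?_⟩
  · obtain ⟨X, hX, rfl⟩ := TangentLift.exists_isSmoothVectorField_eq I x v
    obtain ⟨Y, hY, rfl⟩ := TangentLift.exists_isSmoothVectorField_eq I x w
    exact (hΨ.isTangentToCrossSection_nijenhuis_iff I hV x _ _).1 (h X Y hX hY x)
  · exact (hΨ.isTangentToCrossSection_nijenhuis_iff I hV x _ _).2 (h x _ _)
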